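/- Let $d,N\ge 0$ be integers, and let $B_1,\dots,B_d:\mathbb R^d\to\mathrm{Mat}_{N\times N}(\mathbb K)$ ($\mathbb K=\mathbb R$ or $\mathbb C$) be smooth. Repeated indices are summed over $1,\dots,d$. Put $D_\mu f=\partial_\mu f+B_\mu f$, let $A_1=-D_\mu D_\mu$ be the covariant Laplace operator, and put $$F_{\nu\mu}=\partial_\nu B_\mu-\partial_\mu B_\nu+[B_\nu,B_\mu],\qquad \nabla_\mu G=\partial_\mu G+[B_\mu,G].$$ Consider the system for the Seeley--DeWitt coefficients $a_n(x,y)\in \mathrm{Mat}_{N\times N}(\mathbb K)$ of $A_1$, i.e. the coefficients of the expansion $(4\pi\tau)^{-d/2}e^{-|x-y|^2/(4\tau)}\sum_{n\ge0}\tau^n a_n(x,y)$ of its heat kernel: $$a_0(y,y)=1,\qquad (x-y)^\mu D_{x^\mu}a_0(x,y)=0,\qquad \bigl((n+1)+(x-y)^\mu D_{x^\mu}\bigr)a_{n+1}(x,y)=-A_1a_n(x,y)\quad(n\ge0),$$ where $A_1$ acts on the variable $x$ and each $a_n(x,y)$ is required to be smooth in $x\in\mathbb R^d$ for every fixed $y\in\mathbb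 R^d$. With $z(s)=(1-s)y+sx$, let $\Phi(x,y)=\sum_{n\ge0}\Phi_n(x,y)$, with $\Phi_0=1$ and $\Phi_{n+1}(x,y)=-\int_0^1(x-y)^\nu B_\nu(z(s))\,\Phi_n(z(s),y)\,ds$, be the path-ordered exponential of $-B$ along the segment from $y$ to $x$. Then: 1. The functions given recursively by $a_0(x,y)=\Phi(x,y)$ and $a_{n+1}(x,y)=-\int_0^1 s^n\,\Phi(x,z(s))\,(A_1a_n)(z(s),y)\,ds$ are a solution of this system. 2. For every solution $(a_n)_{n\ge0}$ of this system and every $x\in\mathbb R^d$, $$\begin{aligned}a_3(x,x)={}&\tfrac1{45}\nabla_\mu F_{\tau\nu}(x)\nabla_\mu F_{\tau\nu}(x)+\tfrac1{180}\nabla_\mu F_{\mu\nu}(x)\nabla_\tau F_{\tau\nu}(x)\\&+\tfrac1{60}\bigl(F_{\tau\nu}(x)\nabla_\mu\nabla_\mu F_{\tau\nu}(x)+\nabla_\mu\nabla_\mu F_{\tau\nu}(x)F_{\tau\nu}(x)\bigr)-\tfrac1{30}F_{\tau\mu}(x)F_{\mu\nu}(x)F_{\nu\tau}(x).\end{aligned}$$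 -/

import Mathlib

open scoped ContDiff

attribute [local instance] Matrix.linftyOpNormedRing Matrix.linftyOpNormedAlgebra

noncomputable section

namespace HeatKernel

variable {d : ℕ} {𝔸 : Type*} [NormedRing 𝔸] [NormedAlgebra ℝ 𝔸]

/-- The partial derivative `∂_μ f` of a function on `ℝ^d`. -/
def partialDeriv (μ : Fin d) (f : EuclideanSpace ℝ (Fin d) → 𝔸) :
    EuclideanSpace ℝ (Fin d) → 𝔸 :=
  fun x => fderiv ℝ f x (EuclideanSpace.single μ (1 : ℝ))

/-- The covariant derivative `D_μ f = ∂_μ f + B_μ f`; the field acts by left multiplication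
(for matrix-valued `f` this is the action on each column). -/
def covDeriv (B : Fin d → EuclideanSpace ℝ (Fin d) → 𝔸) (μ : Fin d)
    (f : EuclideanSpace ℝ (Fin d) → 𝔸) : EuclideanSpace ℝ (Fin d) → 𝔸 :=
  fun x => partialDeriv μ f x + B μ x * f x

/-- The covariant Laplace operator `A₁ f = - D_μ D_μ f`. -/
def covLaplace (B : Fin d → EuclideanSpace ℝ (Fin d) → 𝔸)
    (f : EuclideanSpace ℝ (Fin d) → 𝔸) : EuclideanSpace ℝ (Fin d) → 𝔸 :=
  fun x => - ∑ μ, covDeriv B μ (covDeriv B μ f) x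

/-- The field strength `F_{νμ} = ∂_ν B_μ - ∂_μ B_ν + [B_ν, B_μ]`. -/
def fieldStrength (B : Fin d → EuclideanSpace ℝ (Fin d) → 𝔸) (ν μ : Fin d) :
    EuclideanSpace ℝ (Fin d) → 𝔸 :=
  fun x => partialDeriv ν (B μ) x - partialDeriv μ (B ν) x + ⁅B ν x, B μ x⁆

/-- The adjoint covariant derivative `∇_μ G = ∂_μ G + [B_μ, G]`. -/
def adjDeriv (B : Fin d → EuclideanSpace ℝ (Fin d) → 𝔸) (μ : Fin d)
    (G : EuclideanSpace ℝ (Fin d) → 𝔸) : EuclideanSpace ℝ (Fin d) → 𝔸 :=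
  fun x => partialDeriv μ G x + ⁅B μ x, G x⁆

/-- The point `z(s) = (1 - s) y + s x` of the segment from `y` to `x`. -/
def segPoint (x y : EuclideanSpace ℝ (Fin d)) (s : ℝ) : EuclideanSpace ℝ (Fin d) :=
  (1 - s) • y + s • x

/-- The summand of order `n` of the path-ordered exponential: the iterated integral
`(-1)^n ∫ … ∫ ds₁ … dsₙ (dz₁^{ν₁}/ds₁) … (dzₙ^{νₙ}/dsₙ) B_{ν₁}(z₁) … B_{νₙ}(zₙ)`, where `z₁` runs
over the segment from `y` to `x` and `z_j` over the segment from `y` to `z_{j-1}`. -/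
def pExpTerm (B : Fin d → EuclideanSpace ℝ (Fin d) → 𝔸) :
    ℕ → EuclideanSpace ℝ (Fin d) → EuclideanSpace ℝ (Fin d) → 𝔸
  | 0, _, _ => 1
  | n + 1, x, y => - ∫ s in (0 : ℝ)..1,
      (∑ ν, (x ν - y ν) • B ν (segPoint x y s)) * pExpTerm B n (segPoint x y s) y

/-- The path-ordered exponential `Φ(x, y)` of `-B` along the segment from `y` to `x`. -/
def pExp (B : Fin d → EuclideanSpace ℝ (Fin d) → 𝔸) (x y : EuclideanSpace ℝ (Fin d)) : 𝔸 :=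
  ∑' n, pExpTerm B n x y

/-- The Seeley–DeWitt coefficients `a_n(x, y)` of the covariant Laplace operator:
`a₀ = Φ` and `a_{n+1}(x, y) = - ∫₀¹ s^n Φ(x, z(s)) (A₁ a_n)(z(s), y) ds`,
where `A₁` acts on the first argument. -/
def seeleyDeWitt (B : Fin d → EuclideanSpace ℝ (Fin d) → 𝔸) :
    ℕ → EuclideanSpace ℝ (Fin d) → EuclideanSpace ℝ (Fin d) → 𝔸
  | 0 => pExp B
  | n + 1 => fun x y => - ∫ s in (0 : ℝ)..1,
      s ^ n • (pExp B x (segPoint x y s) *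
        covLaplace B (fun z => seeleyDeWitt B n z y) (segPoint x y s))

/-- The classical solutions of the recursive system for the coefficients of the expansion
`K₁(x, y; τ) = (4πτ)^{-d/2} exp(-|x-y|²/(4τ)) ∑ τ^n a_n(x, y)`
of the heat kernel of the covariant Laplace operator. -/
structure IsClassicalSolution (B : Fin d → EuclideanSpace ℝ (Fin d) → 𝔸)
    (a : ℕ → EuclideanSpace ℝ (Fin d) → EuclideanSpace ℝ (Fin d) → 𝔸) : Prop where
  smooth : ∀ n y, ContDiff ℝ ∞ (fun x => a n x y)
  diag_zero : ∀ y, a 0 y y = 1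
  transport_zero : ∀ x y, ∑ μ, (x μ - y μ) • covDeriv B μ (fun z => a 0 z y) x = 0
  transport_succ : ∀ (n : ℕ) x y,
    ((n : ℝ) + 1) • a (n + 1) x y
        + ∑ μ, (x μ - y μ) • covDeriv B μ (fun z => a (n + 1) z y) x
      = - covLaplace B (fun z => a n z y) x

end HeatKernel

end

/-!
Restricted to the segment from `y` to `x`, the series `Φ` is the Neumann series of a Volterra
operator. Its powers decay factorially, so `Φ` is smooth and solves the equation of parallel
transport; uniqueness for this linear equation gives `Φ(x, z) Φ(z, y) = Φ(x, y)` along a segment.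
Since `(x - y)^μ D_μ Φ(x, y) = 0`, the substitution `a_{n+1} = Φ u` replaces `D` by `∂` in the
recursion, and the resulting Euler equation `(n + 1 + (x - y)^μ ∂_μ) u = h` is solved by
`∫₀¹ sⁿ h(z(s)) ds`.

For the diagonal values no equation has to be solved. As `[D_μ, (x - y)^ν] = δ_μ^ν`, the radial
operator `(x - y)^ν D_ν` followed by a word `w` in the `D_μ` and by evaluation at `x = y` gives the
sum of the words obtained from `w` by moving one letter to the end. The recursion thereby turns
`a₃(x, x)` into a linear combination of contracted words of length six applied to `a₀`, and the
transport equation for `a₀` yields linear relations among these words. Modulo these relations the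
combination equals the stated polynomial in the iterated commutators of the `D_μ`.
-/

noncomputable section

namespace HeatKernel

/-! ### Covariant derivatives -/

section CovariantCalculus

variable {d : ℕ} {𝔸 : Type*} [NormedRing 𝔸] [NormedAlgebra ℝ 𝔸]
  {B : Fin d → EuclideanSpace ℝ (Fin d) → 𝔸}
  {f g : EuclideanSpace ℝ (Fin d) → 𝔸} {x : EuclideanSpace ℝ (Fin d)}

theorem partialDeriv_add (hf : DifferentiableAt ℝ f x) (hg : DifferentiableAt ℝ g x) (μ : Fin d) :
    partialDeriv μ (f + g) x = partialDeriv μ f x + partialDeriv μ g x := by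
  simp only [partialDeriv, fderiv_add hf hg, add_apply]

theorem partialDeriv_mul (hf : DifferentiableAt ℝ f x) (hg : DifferentiableAt ℝ g x) (μ : Fin d) :
    partialDeriv μ (f * g) x = partialDeriv μ f x * g x + f x * partialDeriv μ g x := by
  simp [partialDeriv, fderiv_mul' hf hg, add_comm]

theorem partialDeriv_comm (hf : ContDiffAt ℝ 2 f x) (μ ν : Fin d) :
    partialDeriv μ (partialDeriv ν f) x = partialDeriv ν (partialDeriv μ f) x := by
  have hf' : DifferentiableAt ℝ (fderiv ℝ f) x :=
    (hf.fderiv_right (m := 1) le_rfl).differentiableAt one_ne_zero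
  have second (μ ν : Fin d) : partialDeriv μ (partialDeriv ν f) x =
      fderiv ℝ (fderiv ℝ f) x (EuclideanSpace.single μ 1) (EuclideanSpace.single ν 1) := by
    change fderiv ℝ (fun z => fderiv ℝ f z (EuclideanSpace.single ν 1)) x _ = _
    simp [fderiv_clm_apply hf' (differentiableAt_const _)]
  rw [second, second]
  exact (hf.isSymmSndFDerivAt (by simp)).eq _ _

theorem differentiableAt_partialDeriv (hf : ContDiffAt ℝ 2 f x) (μ : Fin d) :
    DifferentiableAt ℝ (partialDeriv μ f) x :=
  ((hf.fderiv_right (m := 1) le_rfl).differentiableAt one_ne_zero).clm_apply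
    (differentiableAt_const _)

theorem covDeriv_add (hf : DifferentiableAt ℝ f x) (hg : DifferentiableAt ℝ g x) (μ : Fin d) :
    covDeriv B μ (f + g) x = covDeriv B μ f x + covDeriv B μ g x := by
  simp only [covDeriv, partialDeriv_add hf hg, Pi.add_apply, mul_add, add_add_add_comm]

theorem covDeriv_const_smul (hf : DifferentiableAt ℝ f x) (c : ℝ) (μ : Fin d) :
    covDeriv B μ (c • f) x = c • covDeriv B μ f x := by
  simp [covDeriv, partialDeriv, fderiv_const_smul hf]

theorem covDeriv_coord_smul (hf : DifferentiableAt ℝ f x) (y : EuclideanSpace ℝ (Fin d))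
    (μ ν : Fin d) :
    covDeriv B μ (fun x => (x ν - y ν) • f x) x =
      (x ν - y ν) • covDeriv B μ f x + if μ = ν then f x else 0 := by
  have coord : HasFDerivAt (fun x : EuclideanSpace ℝ (Fin d) => x ν - y ν)
      (EuclideanSpace.proj ν : EuclideanSpace ℝ (Fin d) →L[ℝ] ℝ) x :=
    (EuclideanSpace.proj ν : EuclideanSpace ℝ (Fin d) →L[ℝ] ℝ).hasFDerivAt.sub_const _
  simp [covDeriv, partialDeriv, (coord.fun_smul hf.hasFDerivAt).fderiv, add_right_comm, eq_comm]

theorem covDeriv_mul_eq_adjDeriv_mul_add (hf : DifferentiableAt ℝ f x)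
    (hg : DifferentiableAt ℝ g x) (μ : Fin d) :
    covDeriv B μ (f * g) x = adjDeriv B μ f x * g x + f x * covDeriv B μ g x := by
  simp only [covDeriv, adjDeriv, partialDeriv_mul hf hg, Pi.mul_apply, Ring.lie_def]
  noncomm_ring

theorem covDeriv_mul_eq_covDeriv_mul_add (hf : DifferentiableAt ℝ f x)
    (hg : DifferentiableAt ℝ g x) (μ : Fin d) :
    covDeriv B μ (f * g) x = covDeriv B μ f x * g x + f x * partialDeriv μ g x := by
  simp only [covDeriv, partialDeriv_mul hf hg, Pi.mul_apply]
  noncomm_ring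

theorem covDeriv_covDeriv (hB : ∀ μ, DifferentiableAt ℝ (B μ) x) (hf : ContDiffAt ℝ 2 f x)
    (μ ν : Fin d) :
    covDeriv B μ (covDeriv B ν f) x = partialDeriv μ (partialDeriv ν f) x +
      (partialDeriv μ (B ν) x * f x + B ν x * partialDeriv μ f x + B μ x * partialDeriv ν f x +
        B μ x * (B ν x * f x)) := by
  have hf₁ : DifferentiableAt ℝ f x := hf.differentiableAt two_ne_zero
  have expand : covDeriv B ν f = partialDeriv ν f + B ν * f := rfl
  rw [expand, covDeriv, partialDeriv_add (differentiableAt_partialDeriv hf ν) ((hB ν).mul hf₁),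
    partialDeriv_mul (hB ν) hf₁]
  simp only [Pi.add_apply, Pi.mul_apply]
  noncomm_ring

theorem covDeriv_covDeriv_sub (hB : ∀ μ, DifferentiableAt ℝ (B μ) x) (hf : ContDiffAt ℝ 2 f x)
    (μ ν : Fin d) :
    covDeriv B μ (covDeriv B ν f) x - covDeriv B ν (covDeriv B μ f) x =
      fieldStrength B μ ν x * f x := by
  rw [covDeriv_covDeriv hB hf, covDeriv_covDeriv hB hf, partialDeriv_comm hf μ ν, fieldStrength,
    Ring.lie_def]
  noncomm_ring

end CovariantCalculus

section Smoothness

variable {d : ℕ} {𝔸 : Type*} [NormedRing 𝔸] [NormedAlgebra ℝ 𝔸]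
  {B : Fin d → EuclideanSpace ℝ (Fin d) → 𝔸}
  {f : EuclideanSpace ℝ (Fin d) → 𝔸}

theorem contDiff_partialDeriv (hf : ContDiff ℝ ∞ f) (μ : Fin d) :
    ContDiff ℝ ∞ (partialDeriv μ f) :=
  (hf.fderiv_right (m := ∞) le_rfl).clm_apply contDiff_const

theorem contDiff_covDeriv (hB : ∀ μ, ContDiff ℝ ∞ (B μ)) (hf : ContDiff ℝ ∞ f) (μ : Fin d) :
    ContDiff ℝ ∞ (covDeriv B μ f) :=
  (contDiff_partialDeriv hf μ).add ((hB μ).mul hf)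

theorem contDiff_covLaplace (hB : ∀ μ, ContDiff ℝ ∞ (B μ)) (hf : ContDiff ℝ ∞ f) :
    ContDiff ℝ ∞ (covLaplace B f) :=
  (ContDiff.sum fun μ _ => contDiff_covDeriv hB (contDiff_covDeriv hB hf μ) μ).neg

theorem contDiff_fieldStrength (hB : ∀ μ, ContDiff ℝ ∞ (B μ)) (μ ν : Fin d) :
    ContDiff ℝ ∞ (fieldStrength B μ ν) :=
  ((contDiff_partialDeriv (hB ν) μ).sub (contDiff_partialDeriv (hB μ) ν)).add
    (((hB μ).mul (hB ν)).sub ((hB ν).mul (hB μ)))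

theorem contDiff_adjDeriv (hB : ∀ μ, ContDiff ℝ ∞ (B μ)) (hf : ContDiff ℝ ∞ f) (μ : Fin d) :
    ContDiff ℝ ∞ (adjDeriv B μ f) :=
  (contDiff_partialDeriv hf μ).add (((hB μ).mul hf).sub (hf.mul (hB μ)))

end Smoothness

open Set unitInterval

/-! ### Integrals depending smoothly on parameters -/

section ParametricSmoothness

variable {X E : Type*} [NormedAddCommGroup X] [NormedAddCommGroup E]

/-- A continuous function `f` on `X × ℝ` as the family of the continuous functions `t ↦ f (x, t)`
on the unit interval, depending continuously on the parameter `x`. -/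
def curryUnit (f : X × ℝ → E) (hf : Continuous f) : C(X, C(I, E)) :=
  ContinuousMap.curry ⟨fun p => f (p.1, p.2), by fun_prop⟩

variable [NormedSpace ℝ X] [NormedSpace ℝ E]

/-- A continuous family of linear maps as a linear map into the continuous families of values. -/
def flipUnit (φ : C(I, X →L[ℝ] E)) : X →L[ℝ] C(I, E) :=
  LinearMap.mkContinuous
    { toFun v := ⟨fun t => φ t v, by fun_prop⟩
      map_add' v w := ContinuousMap.ext fun t => map_add (φ t) v w
      map_smul' c v := ContinuousMap.ext fun t => map_smul (φ t) c v }
    ‖φ‖ fun v => (ContinuousMap.norm_le _ (by positivity)).2 fun t =>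
      (φ t).le_of_opNorm_le (φ.norm_coe_le_norm t) v

/-- The partial derivative of a function on `X × ℝ` in its first argument. -/
def fderivFst (f : X × ℝ → E) (p : X × ℝ) : X →L[ℝ] E :=
  (fderiv ℝ f p).comp (.inl ℝ X ℝ)

theorem contDiff_fderivFst {f : X × ℝ → E} {n : ℕ} (hf : ContDiff ℝ (n + 1 : ℕ) f) :
    ContDiff ℝ n (fderivFst f) :=
  (hf.fderiv_right (by simp)).clm_comp contDiff_const

theorem continuous_fderivFst {f : X × ℝ → E} (hf : ContDiff ℝ 1 f) : Continuous (fderivFst f) :=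
  (hf.continuous_fderiv one_ne_zero).clm_comp continuous_const

theorem hasFDerivAt_curryUnit {f : X × ℝ → E} (hf : ContDiff ℝ 1 f) (x : X) :
    HasFDerivAt (curryUnit f hf.continuous)
      (flipUnit (curryUnit (fderivFst f) (continuous_fderivFst hf) x)) x := by
  have partial_deriv (z : X) (t : ℝ) : HasFDerivAt (fun z => f (z, t)) (fderivFst f (z, t)) z :=
    (hf.differentiable one_ne_zero (z, t)).hasFDerivAt.comp z (hasFDerivAt_prodMk_left z t)
  rw [hasFDerivAt_iff_isLittleO, Asymptotics.isLittleO_iff]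
  intro ε hε
  obtain ⟨δ, hδ, hball⟩ := Metric.continuousAt_iff.1
    (curryUnit (fderivFst f) (continuous_fderivFst hf)).continuous.continuousAt ε hε
  filter_upwards [Metric.ball_mem_nhds x hδ] with z hz
  rw [ContinuousMap.norm_le _ (by positivity)]
  intro t
  have deriv_close (w : X) (hw : w ∈ Metric.ball x δ) :
      ‖fderivFst f (w, t) - fderivFst f (x, t)‖ ≤ ε :=
    (dist_eq_norm (fderivFst f (w, t)) _).symm.trans_le <|
      (ContinuousMap.dist_apply_le_dist t).trans (hball hw).le
  exact (convex_ball x δ).norm_image_sub_le_of_norm_hasFDerivWithin_le'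
    (fun w _ => (partial_deriv w t).hasFDerivWithinAt) deriv_close (Metric.mem_ball_self hδ) hz

theorem contDiff_curryUnit [FiniteDimensional ℝ X] {n : ℕ} {f : X × ℝ → E}
    (hf : ContDiff ℝ n f) : ContDiff ℝ n (curryUnit f hf.continuous) := by
  induction n generalizing f with
  | zero => exact contDiff_zero.2 (curryUnit f hf.continuous).continuous
  | succ n ih =>
    have hf₁ : ContDiff ℝ 1 f := hf.of_le (by simp)
    change ContDiff ℝ (n + 1) _
    rw [contDiff_succ_iff_fderiv_apply]
    refine ⟨fun x => (hasFDerivAt_curryUnit hf₁ x).differentiableAt, by simp, fun v => ?_⟩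
    simp only [(hasFDerivAt_curryUnit hf₁ _).fderiv]
    exact ih ((contDiff_fderivFst hf).clm_apply contDiff_const)

theorem contDiff_infty_curryUnit [FiniteDimensional ℝ X] {f : X × ℝ → E} (hf : ContDiff ℝ ∞ f) :
    ContDiff ℝ ∞ (curryUnit f hf.continuous) :=
  contDiff_infty.2 fun n => contDiff_curryUnit (contDiff_infty.1 hf n)

/-- The primitive `s ↦ ∫₀ˢ g` of a continuous function on the unit interval. -/
def primitiveUnit (E : Type*) [NormedAddCommGroup E] [NormedSpace ℝ E] :
    C(I, E) →L[ℝ] C(I, E) :=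
  LinearMap.mkContinuous
    { toFun g := ⟨fun s => ∫ t in (0 : ℝ)..s, g (projIcc 0 1 zero_le_one t),
        (intervalIntegral.continuous_primitive (fun a b =>
          Continuous.intervalIntegrable (by fun_prop) a b) 0).comp continuous_subtype_val⟩
      map_add' g h := ContinuousMap.ext fun s =>
        intervalIntegral.integral_add (Continuous.intervalIntegrable (by fun_prop) _ _)
          (Continuous.intervalIntegrable (by fun_prop) _ _)
      map_smul' c g := ContinuousMap.ext fun s => intervalIntegral.integral_smul c _ }
    1 fun g => (ContinuousMap.norm_le _ (by positivity)).2 fun s => by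
      refine (intervalIntegral.norm_integral_le_of_norm_le_const fun t _ =>
        g.norm_coe_le_norm _).trans ?_
      rw [sub_zero, abs_of_nonneg s.2.1, one_mul]
      exact mul_le_of_le_one_right (norm_nonneg _) s.2.2

theorem primitiveUnit_apply (g : C(I, E)) (s : I) :
    primitiveUnit E g s = ∫ t in (0 : ℝ)..s, g (projIcc 0 1 zero_le_one t) := rfl

theorem primitiveUnit_eq {g : C(I, E)} {f : ℝ → E} (h : ∀ t : I, g t = f t) (s : I) :
    primitiveUnit E g s = ∫ t in (0 : ℝ)..s, f t := by
  refine intervalIntegral.integral_congr fun t ht => ?_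
  rw [uIcc_of_le s.2.1] at ht
  simp only [h, projIcc_of_mem zero_le_one (show t ∈ Icc 0 1 from ⟨ht.1, ht.2.trans s.2.2⟩)]

theorem contDiff_integral_unit [FiniteDimensional ℝ X] {f : X × ℝ → E} (hf : ContDiff ℝ ∞ f) :
    ContDiff ℝ ∞ fun x => ∫ t in (0 : ℝ)..1, f (x, t) := by
  have eval_primitive (x : X) : ∫ t in (0 : ℝ)..1, f (x, t) =
      ContinuousMap.evalCLM ℝ (1 : I) (primitiveUnit E (curryUnit f hf.continuous x)) :=
    (primitiveUnit_eq (g := curryUnit f hf.continuous x) (fun _ => rfl) 1).symm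
  simp only [eval_primitive]
  exact (ContinuousMap.evalCLM ℝ (1 : I)).contDiff.comp
    ((primitiveUnit E).contDiff.comp (contDiff_infty_curryUnit hf))

end ParametricSmoothness

/-! ### Volterra equations -/

section NeumannSeries

variable {R : Type*} [NormedRing R] [CompleteSpace R] {C : ℝ}

theorem summable_pow_of_norm_pow_le (x : R) (h : ∀ n : ℕ, ‖x ^ n‖ ≤ C ^ n / n.factorial) :
    Summable fun n => x ^ n :=
  .of_norm_bounded (Real.summable_pow_div_factorial C) h

/-- The unit `1 - x` with inverse the Neumann series, for an element `x` whose powers decay like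
those of a Volterra operator. -/
def unitOneSub (x : R) (h : ∀ n : ℕ, ‖x ^ n‖ ≤ C ^ n / n.factorial) : Rˣ where
  val := 1 - x
  inv := ∑' n, x ^ n
  val_inv := (summable_pow_of_norm_pow_le x h).one_sub_mul_tsum_pow
  inv_val := (summable_pow_of_norm_pow_le x h).tsum_pow_mul_one_sub

theorem contDiffAt_inverse_one_sub [NormedAlgebra ℝ R] {V : Type*} [NormedAddCommGroup V]
    [NormedSpace ℝ V] (T : V →L[ℝ] R) {b : V} (h : ∀ n : ℕ, ‖T b ^ n‖ ≤ C ^ n / n.factorial) :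
    ContDiffAt ℝ ∞ (fun b => Ring.inverse (1 - T b)) b :=
  ContDiffAt.comp b (g := Ring.inverse) (f := fun b => 1 - T b)
    (contDiffAt_ringInverse ℝ (unitOneSub (T b) h)) (contDiff_const.sub T.contDiff).contDiffAt

end NeumannSeries

section Volterra

variable {𝔸 : Type*} [NormedRing 𝔸] [NormedAlgebra ℝ 𝔸]

/-- The Volterra operator `u ↦ (s ↦ ∫₀ˢ b u)`. -/
def volterra : C(I, 𝔸) →L[ℝ] C(I, 𝔸) →L[ℝ] C(I, 𝔸) :=
  (ContinuousLinearMap.compL ℝ C(I, 𝔸) C(I, 𝔸) C(I, 𝔸) (primitiveUnit 𝔸)).comp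
    (ContinuousLinearMap.mul ℝ C(I, 𝔸))

theorem volterra_apply (b u : C(I, 𝔸)) : volterra b u = primitiveUnit 𝔸 (b * u) := rfl

theorem norm_volterra_pow_apply_le (b u : C(I, 𝔸)) (n : ℕ) (s : I) :
    ‖(volterra b ^ n) u s‖ ≤ (‖b‖ * s) ^ n / n.factorial * ‖u‖ := by
  induction n generalizing s with
  | zero => simpa using u.norm_coe_le_norm s
  | succ n ih =>
    have integrand_le (t : ℝ) (ht : t ∈ Ioc (0 : ℝ) s) :
        ‖(b * (volterra b ^ n) u) (projIcc 0 1 zero_le_one t)‖ ≤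
          ‖b‖ ^ (n + 1) / n.factorial * ‖u‖ * t ^ n := by
      have ht' : t ∈ Icc (0 : ℝ) 1 := ⟨ht.1.le, ht.2.trans s.2.2⟩
      rw [projIcc_of_mem zero_le_one ht', ContinuousMap.mul_apply]
      calc ‖b ⟨t, ht'⟩ * (volterra b ^ n) u ⟨t, ht'⟩‖
          ≤ ‖b‖ * ((‖b‖ * t) ^ n / n.factorial * ‖u‖) :=
            norm_mul_le_of_le (b.norm_coe_le_norm _) (ih ⟨t, ht'⟩)
        _ = ‖b‖ ^ (n + 1) / n.factorial * ‖u‖ * t ^ n := by ring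
    calc ‖(volterra b ^ (n + 1)) u s‖
        ≤ ∫ t in (0 : ℝ)..s, ‖b‖ ^ (n + 1) / n.factorial * ‖u‖ * t ^ n := by
          rw [pow_succ', mul_apply_eq_comp, volterra_apply, primitiveUnit_apply]
          exact intervalIntegral.norm_integral_le_of_norm_le s.2.1 (.of_forall integrand_le)
            (Continuous.intervalIntegrable (by fun_prop) _ _)
      _ = (‖b‖ * s) ^ (n + 1) / (n + 1).factorial * ‖u‖ := by
          rw [intervalIntegral.integral_const_mul, integral_pow, Nat.factorial_succ,
            zero_pow n.succ_ne_zero]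
          push_cast
          field_simp
          ring

theorem norm_volterra_pow_le (b : C(I, 𝔸)) (n : ℕ) :
    ‖volterra b ^ n‖ ≤ ‖b‖ ^ n / n.factorial := by
  refine ContinuousLinearMap.opNorm_le_bound _ (by positivity) fun u =>
    (ContinuousMap.norm_le _ (by positivity)).2 fun s =>
      (norm_volterra_pow_apply_le b u n s).trans ?_
  have s_nonneg : (0 : ℝ) ≤ s := s.2.1
  gcongr
  exact mul_le_of_le_one_right (norm_nonneg _) s.2.2

variable [CompleteSpace 𝔸]

/-- The unit `1 - V_b` of the algebra of operators, where `V_b` is the Volterra operator. -/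
def volterraUnit (b : C(I, 𝔸)) : (C(I, 𝔸) →L[ℝ] C(I, 𝔸))ˣ :=
  unitOneSub (volterra b) (norm_volterra_pow_le b)

/-- The solution `u` of the Volterra equation `u(s) = 1 + ∫₀ˢ b u`. -/
def volterraSolution (b : C(I, 𝔸)) : C(I, 𝔸) := (∑' n, volterra b ^ n) 1

theorem volterraSolution_eq (b : C(I, 𝔸)) :
    volterraSolution b = 1 + volterra b (volterraSolution b) := by
  have h : ((1 - volterra b) * ∑' n, volterra b ^ n) 1 = (1 : C(I, 𝔸)) :=
    DFunLike.congr_fun (volterraUnit b).val_inv 1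
  exact eq_add_of_sub_eq h

theorem hasSum_volterraSolution (b : C(I, 𝔸)) (s : I) :
    HasSum (fun n => (volterra b ^ n) (1 : C(I, 𝔸)) s) (volterraSolution b s) := by
  have h : HasSum (fun n => (volterra b ^ n) (1 : C(I, 𝔸))) (volterraSolution b) :=
    (summable_pow_of_norm_pow_le (volterra b) (norm_volterra_pow_le b)).hasSum.mapL
      (ContinuousLinearMap.apply ℝ C(I, 𝔸) 1)
  exact h.mapL (ContinuousMap.evalCLM ℝ s)

theorem contDiff_volterraSolution : ContDiff ℝ ∞ (volterraSolution : C(I, 𝔸) → C(I, 𝔸)) := by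
  have inverse_eq (b : C(I, 𝔸)) : volterraSolution b = Ring.inverse (1 - volterra b) 1 := by
    have h : Ring.inverse (1 - volterra b) = ∑' n, volterra b ^ n :=
      Ring.inverse_unit (volterraUnit b)
    rw [h]
    rfl
  rw [funext inverse_eq]
  refine ContDiff.clm_apply ?_ contDiff_const
  rw [contDiff_iff_contDiffAt]
  intro b
  exact contDiffAt_inverse_one_sub _ (norm_volterra_pow_le b)

end Volterra

section LinearODE

variable {𝔸 : Type*} [NormedRing 𝔸] [NormedAlgebra ℝ 𝔸]

theorem eq_of_hasDerivAt_mul {c f g : ℝ → 𝔸} (hc : Continuous c)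
    (hf : ∀ t, HasDerivAt f (c t * f t) t) (hg : ∀ t, HasDerivAt g (c t * g t) t) {r : ℝ}
    (h : f r = g r) : f = g := by
  funext t
  obtain ⟨a, ha⟩ := exists_lt (min r t)
  obtain ⟨b, hb⟩ := exists_gt (max r t)
  obtain ⟨har, hat⟩ := lt_min_iff.1 ha
  obtain ⟨hrb, htb⟩ := max_lt_iff.1 hb
  obtain ⟨K, hK⟩ := (isCompact_Icc (a := a) (b := b)).exists_bound_of_continuousOn hc.continuousOn
  have lipschitz (s : ℝ) (hs : s ∈ Ioo a b) :
      LipschitzOnWith K.toNNReal (fun w => c s * w) univ :=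
    LipschitzOnWith.of_dist_le_mul fun u _ w _ => by
      rw [dist_eq_norm, dist_eq_norm, ← mul_sub]
      exact norm_mul_le_of_le
        ((hK s (Ioo_subset_Icc_self hs)).trans (Real.le_coe_toNNReal K)) le_rfl
  exact ODE_solution_unique_of_mem_Icc (v := fun s w => c s * w) lipschitz ⟨har, hrb⟩
    (fun s _ => (hf s).continuousAt.continuousWithinAt) (fun s _ => hf s) (fun _ _ => mem_univ _)
    (fun s _ => (hg s).continuousAt.continuousWithinAt) (fun s _ => hg s) (fun _ _ => mem_univ _)
    h ⟨hat.le, htb.le⟩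

end LinearODE

variable {d : ℕ} {𝔸 : Type*} [NormedRing 𝔸] [NormedAlgebra ℝ 𝔸]

section Segment

variable (x y : EuclideanSpace ℝ (Fin d))

theorem segPoint_segPoint (s t : ℝ) : segPoint (segPoint x y s) y t = segPoint x y (s * t) := by
  simp only [segPoint]
  module

theorem segPoint_zero : segPoint x y 0 = y := by
  simp [segPoint]

theorem segPoint_one : segPoint x y 1 = x := by
  simp [segPoint]

theorem segPoint_translate (r t : ℝ) :
    segPoint (segPoint x y r + (x - y)) (segPoint x y r) (t - r) = segPoint x y t := by
  simp only [segPoint]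
  module

theorem segPoint_apply_sub (s : ℝ) (ν : Fin d) : segPoint x y s ν - y ν = s * (x ν - y ν) := by
  simp only [segPoint, PiLp.add_apply, PiLp.smul_apply, smul_eq_mul]
  ring

theorem contDiff_segPoint :
    ContDiff ℝ ∞ fun p : EuclideanSpace ℝ (Fin d) × ℝ => segPoint p.1 y p.2 := by
  unfold segPoint
  fun_prop

theorem continuous_segPoint : Continuous (segPoint x y) := by
  unfold segPoint
  fun_prop

theorem hasDerivAt_segPoint (t : ℝ) : HasDerivAt (segPoint x y) (x - y) t := by
  have affine : segPoint x y = fun s => y + s • (x - y) := by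
    funext s
    simp only [segPoint]
    module
  rw [affine]
  simpa using ((hasDerivAt_id t).smul_const (x - y)).const_add y

theorem hasDerivAt_comp_segPoint {f : EuclideanSpace ℝ (Fin d) → 𝔸} {t : ℝ}
    (hf : DifferentiableAt ℝ f (segPoint x y t)) :
    HasDerivAt (fun t => f (segPoint x y t))
      (∑ μ, (x μ - y μ) • partialDeriv μ f (segPoint x y t)) t := by
  have velocity : x - y = ∑ μ, (x μ - y μ) • EuclideanSpace.single μ (1 : ℝ) := by
    ext ν
    simp [Pi.single_apply]
  have directional : ∑ μ, (x μ - y μ) • partialDeriv μ f (segPoint x y t) =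
      fderiv ℝ f (segPoint x y t) (x - y) := by
    simp only [velocity, map_sum, map_smul, partialDeriv]
  rw [directional]
  exact hf.hasFDerivAt.comp_hasDerivAt t (hasDerivAt_segPoint x y t)

end Segment

/-! ### The path-ordered exponential -/

section PathOrderedExponential

/-- The generator `-(x - y)^ν B_ν(z(s))` of parallel transport along the segment from `y` to `x`,
as a function of `(x, s)`. -/
def transportGenerator (B : Fin d → EuclideanSpace ℝ (Fin d) → 𝔸) (y : EuclideanSpace ℝ (Fin d))
    (p : EuclideanSpace ℝ (Fin d) × ℝ) : 𝔸 :=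
  -∑ ν, (p.1 ν - y ν) • B ν (segPoint p.1 y p.2)

variable {B : Fin d → EuclideanSpace ℝ (Fin d) → 𝔸}

theorem transportGenerator_segPoint (x y : EuclideanSpace ℝ (Fin d)) (s t : ℝ) :
    transportGenerator B y (segPoint x y s, t) = s • transportGenerator B y (x, s * t) := by
  simp only [transportGenerator, segPoint_segPoint, segPoint_apply_sub, smul_neg, Finset.smul_sum,
    mul_smul]

theorem transportGenerator_translate (x y : EuclideanSpace ℝ (Fin d)) (r t : ℝ) :
    transportGenerator B (segPoint x y r) (segPoint x y r + (x - y), t - r) =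
      transportGenerator B y (x, t) := by
  simp [transportGenerator, segPoint_translate]

theorem pExpTerm_succ_segPoint (n : ℕ) (x y : EuclideanSpace ℝ (Fin d)) (s : ℝ) :
    pExpTerm B (n + 1) (segPoint x y s) y =
      ∫ t in (0 : ℝ)..s, transportGenerator B y (x, t) * pExpTerm B n (segPoint x y t) y := by
  have rescale := intervalIntegral.smul_integral_comp_mul_left (a := 0) (b := 1)
    (fun t => transportGenerator B y (x, t) * pExpTerm B n (segPoint x y t) y) s
  rw [mul_zero, mul_one] at rescale
  rw [← rescale, ← intervalIntegral.integral_smul]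
  simp only [← smul_mul_assoc, ← transportGenerator_segPoint, ← segPoint_segPoint]
  simp only [pExpTerm, transportGenerator, neg_mul, intervalIntegral.integral_neg]

theorem contDiff_transportGenerator (hB : ∀ μ, ContDiff ℝ ∞ (B μ))
    (y : EuclideanSpace ℝ (Fin d)) : ContDiff ℝ ∞ (transportGenerator B y) :=
  (ContDiff.sum fun ν _ => ContDiff.smul
    (f := fun p : EuclideanSpace ℝ (Fin d) × ℝ => p.1 ν - y ν) (by fun_prop)
    ((hB ν).comp (contDiff_segPoint y))).neg

variable (hB : ∀ μ, ContDiff ℝ ∞ (B μ))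

/-- The generator of parallel transport on the unit interval, depending continuously on the end
point of the segment. -/
def generatorUnit (y : EuclideanSpace ℝ (Fin d)) : C(EuclideanSpace ℝ (Fin d), C(I, 𝔸)) :=
  curryUnit (transportGenerator B y) (contDiff_transportGenerator hB y).continuous

theorem pExpTerm_segPoint (n : ℕ) (x y : EuclideanSpace ℝ (Fin d)) (s : I) :
    pExpTerm B n (segPoint x y s) y = (volterra (generatorUnit hB y x) ^ n) 1 s := by
  induction n generalizing s with
  | zero => rfl
  | succ n ih =>
    rw [pExpTerm_succ_segPoint, pow_succ', mul_apply_eq_comp, volterra_apply]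
    exact (primitiveUnit_eq (fun t => congrArg (generatorUnit hB y x t * ·) (ih t).symm) s).symm

variable [CompleteSpace 𝔸]

theorem pExp_segPoint (x y : EuclideanSpace ℝ (Fin d)) (s : I) :
    pExp B (segPoint x y s) y = volterraSolution (generatorUnit hB y x) s := by
  simp only [pExp, pExpTerm_segPoint hB, (hasSum_volterraSolution _ s).tsum_eq]

theorem pExp_eq_volterraSolution (x y : EuclideanSpace ℝ (Fin d)) :
    pExp B x y = volterraSolution (generatorUnit hB y x) 1 := by
  simpa only [Icc.coe_one, segPoint_one] using pExp_segPoint hB x y 1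

include hB in
theorem contDiff_pExp (y : EuclideanSpace ℝ (Fin d)) : ContDiff ℝ ∞ fun x => pExp B x y := by
  simp only [pExp_eq_volterraSolution hB]
  exact (ContinuousMap.evalCLM ℝ (1 : I)).contDiff.comp (contDiff_volterraSolution.comp
    (contDiff_infty_curryUnit (contDiff_transportGenerator hB y)))

include hB

theorem pExp_eq_one_add_integral (x y : EuclideanSpace ℝ (Fin d)) :
    pExp B x y =
      1 + ∫ t in (0 : ℝ)..1, transportGenerator B y (x, t) * pExp B (segPoint x y t) y := by
  rw [pExp_eq_volterraSolution hB, volterraSolution_eq, ContinuousMap.add_apply, volterra_apply]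
  congr 1
  refine primitiveUnit_eq (fun t => ?_) 1
  rw [ContinuousMap.mul_apply, ← pExp_segPoint]
  rfl

theorem pExp_segPoint_eq_one_add_integral (x y : EuclideanSpace ℝ (Fin d)) (s : ℝ) :
    pExp B (segPoint x y s) y =
      1 + ∫ t in (0 : ℝ)..s, transportGenerator B y (x, t) * pExp B (segPoint x y t) y := by
  have rescale := intervalIntegral.smul_integral_comp_mul_left (a := 0) (b := 1)
    (fun t => transportGenerator B y (x, t) * pExp B (segPoint x y t) y) s
  rw [mul_zero, mul_one] at rescale
  rw [← rescale, ← intervalIntegral.integral_smul, pExp_eq_one_add_integral hB]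
  simp only [transportGenerator_segPoint, segPoint_segPoint, smul_mul_assoc]

theorem pExp_self (y : EuclideanSpace ℝ (Fin d)) : pExp B y y = 1 := by
  rw [pExp_eq_one_add_integral hB]
  simp [transportGenerator]

theorem hasDerivAt_pExp_segPoint (x y : EuclideanSpace ℝ (Fin d)) (s : ℝ) :
    HasDerivAt (fun s => pExp B (segPoint x y s) y)
      (transportGenerator B y (x, s) * pExp B (segPoint x y s) y) s := by
  have integrand : Continuous fun t : ℝ =>
      transportGenerator B y (x, t) * pExp B (segPoint x y t) y :=
    ((contDiff_transportGenerator hB y).continuous.comp (by fun_prop)).mul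
      ((contDiff_pExp hB y).continuous.comp (continuous_segPoint x y))
  exact ((integrand.integral_hasStrictDerivAt 0 s).hasDerivAt.const_add 1).congr_of_eventuallyEq
    (.of_forall (pExp_segPoint_eq_one_add_integral hB x y))

theorem hasDerivAt_pExp_segPoint_segPoint (x y : EuclideanSpace ℝ (Fin d)) (r t : ℝ) :
    HasDerivAt (fun t => pExp B (segPoint x y t) (segPoint x y r))
      (transportGenerator B y (x, t) * pExp B (segPoint x y t) (segPoint x y r)) t := by
  simpa only [segPoint_translate, transportGenerator_translate] using
    (hasDerivAt_pExp_segPoint hB (segPoint x y r + (x - y)) (segPoint x y r)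
      (t - r)).comp_sub_const t r

theorem pExp_segPoint_mul (x y : EuclideanSpace ℝ (Fin d)) (t r q : ℝ) :
    pExp B (segPoint x y t) (segPoint x y r) * pExp B (segPoint x y r) (segPoint x y q) =
      pExp B (segPoint x y t) (segPoint x y q) := by
  have generator : Continuous fun t : ℝ => transportGenerator B y (x, t) :=
    (contDiff_transportGenerator hB y).continuous.comp (by fun_prop)
  refine congrFun (f := fun t => pExp B (segPoint x y t) (segPoint x y r) *
      pExp B (segPoint x y r) (segPoint x y q)) (eq_of_hasDerivAt_mul (r := r) generator
    (fun t => ?_) (hasDerivAt_pExp_segPoint_segPoint hB x y q) ?_) t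
  · simpa only [mul_assoc] using (hasDerivAt_pExp_segPoint_segPoint hB x y r t).mul_const
      (pExp B (segPoint x y r) (segPoint x y q))
  · simp only [pExp_self hB, one_mul]

theorem pExp_mul_pExp_symm (x y : EuclideanSpace ℝ (Fin d)) : pExp B x y * pExp B y x = 1 := by
  simpa only [segPoint_zero, segPoint_one, pExp_self hB] using pExp_segPoint_mul hB x y 1 0 1

theorem pExp_mul_pExp_segPoint (x y : EuclideanSpace ℝ (Fin d)) (s : ℝ) :
    pExp B x y * pExp B y (segPoint x y s) = pExp B x (segPoint x y s) := by
  simpa only [segPoint_zero, segPoint_one] using pExp_segPoint_mul hB x y 1 0 s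

omit hB in
/-- The path-ordered exponential as a unit; its inverse is the one of the reversed segment. -/
def pExpUnit (x y : EuclideanSpace ℝ (Fin d)) : 𝔸ˣ where
  val := pExp B x y
  inv := pExp B y x
  val_inv := pExp_mul_pExp_symm hB x y
  inv_val := pExp_mul_pExp_symm hB y x

theorem contDiff_pExp_right (x : EuclideanSpace ℝ (Fin d)) : ContDiff ℝ ∞ fun y => pExp B x y := by
  have inverse_eq (y : EuclideanSpace ℝ (Fin d)) : pExp B x y = Ring.inverse (pExp B y x) :=
    (Ring.inverse_unit (pExpUnit hB y x)).symm
  simp only [inverse_eq]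
  exact contDiff_iff_contDiffAt.2 fun y =>
    ContDiffAt.comp y (g := Ring.inverse) (f := fun y => pExp B y x)
      (contDiffAt_ringInverse ℝ (pExpUnit hB y x)) (contDiff_pExp hB x).contDiffAt

theorem sum_smul_covDeriv_pExp (x y : EuclideanSpace ℝ (Fin d)) :
    ∑ μ, (x μ - y μ) • covDeriv B μ (fun z => pExp B z y) x = 0 := by
  have radial_deriv : ∑ μ, (x μ - y μ) • partialDeriv μ (fun z => pExp B z y) x =
      transportGenerator B y (x, 1) * pExp B x y := by
    simpa only [segPoint_one] using (hasDerivAt_comp_segPoint x y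
      ((contDiff_pExp hB y).differentiable (by simp) (segPoint x y 1))).unique
      (hasDerivAt_pExp_segPoint hB x y 1)
  simp only [covDeriv, smul_add, Finset.sum_add_distrib, radial_deriv, transportGenerator,
    segPoint_one, neg_mul, Finset.sum_mul, smul_mul_assoc, neg_add_cancel]

end PathOrderedExponential

/-! ### The recursion for the Seeley–DeWitt coefficients -/

section RadialIntegral

/-- The integral `∫₀¹ sⁿ h(z(s)) ds` over the segment from `y` to `x`: as a function of `x`, the
smooth solution `u` of `(n + 1 + (x - y)^μ ∂_μ) u = h`. -/
def radialIntegral (n : ℕ) (h : EuclideanSpace ℝ (Fin d) → 𝔸) (y x : EuclideanSpace ℝ (Fin d)) :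
    𝔸 :=
  ∫ s in (0 : ℝ)..1, s ^ n • h (segPoint x y s)

variable {h : EuclideanSpace ℝ (Fin d) → 𝔸}

theorem contDiff_radialIntegral (hh : ContDiff ℝ ∞ h) (n : ℕ) (y : EuclideanSpace ℝ (Fin d)) :
    ContDiff ℝ ∞ (radialIntegral n h y) :=
  contDiff_integral_unit
    (f := fun p : EuclideanSpace ℝ (Fin d) × ℝ => p.2 ^ n • h (segPoint p.1 y p.2))
    ((contDiff_snd.pow n).smul (hh.comp (contDiff_segPoint y)))

theorem pow_smul_radialIntegral_segPoint (n : ℕ) (x y : EuclideanSpace ℝ (Fin d)) (t : ℝ) :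
    t ^ (n + 1) • radialIntegral n h y (segPoint x y t) =
      ∫ s in (0 : ℝ)..t, s ^ n • h (segPoint x y s) := by
  have rescale := intervalIntegral.smul_integral_comp_mul_left (a := 0) (b := 1)
    (fun s : ℝ => s ^ n • h (segPoint x y s)) t
  rw [mul_zero, mul_one] at rescale
  rw [← rescale, pow_succ', mul_smul, radialIntegral, ← intervalIntegral.integral_smul (t ^ n)]
  simp only [segPoint_segPoint, mul_pow, mul_smul]

theorem mul_radialIntegral [CompleteSpace 𝔸] (hh : Continuous h) (c : 𝔸) (n : ℕ)
    (y x : EuclideanSpace ℝ (Fin d)) :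
    c * radialIntegral n h y x = radialIntegral n (fun z => c * h z) y x := by
  have integrand : Continuous fun s : ℝ => s ^ n • h (segPoint x y s) :=
    (continuous_pow n).smul (hh.comp (continuous_segPoint x y))
  have pull_out := (ContinuousLinearMap.mul ℝ 𝔸 c).intervalIntegral_comp_comm
    (integrand.intervalIntegrable (μ := MeasureTheory.volume) 0 1)
  simpa only [radialIntegral, ContinuousLinearMap.mul_apply', mul_smul_comm] using pull_out.symm

theorem euler_radialIntegral [CompleteSpace 𝔸] (hh : ContDiff ℝ ∞ h) (n : ℕ)
    (x y : EuclideanSpace ℝ (Fin d)) :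
    ((n : ℝ) + 1) • radialIntegral n h y x +
      ∑ μ, (x μ - y μ) • partialDeriv μ (radialIntegral n h y) x = h x := by
  have integrand : Continuous fun s : ℝ => s ^ n • h (segPoint x y s) :=
    (continuous_pow n).smul (hh.continuous.comp (continuous_segPoint x y))
  have deriv_integral := (integrand.integral_hasStrictDerivAt 0 1).hasDerivAt
  simp only [← pow_smul_radialIntegral_segPoint n x y] at deriv_integral
  have deriv_product := (hasDerivAt_pow (n + 1) (1 : ℝ)).smul (hasDerivAt_comp_segPoint x y
    ((contDiff_radialIntegral hh n y).differentiable (by simp) (segPoint x y 1)))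
  have eq := deriv_product.unique deriv_integral
  simp only [one_pow, one_smul, mul_one, segPoint_one, Nat.cast_succ] at eq
  rw [← eq, add_comm]

end RadialIntegral

section Solution

variable [CompleteSpace 𝔸] {B : Fin d → EuclideanSpace ℝ (Fin d) → 𝔸}
  (hB : ∀ μ, ContDiff ℝ ∞ (B μ))
include hB

theorem sum_smul_covDeriv_pExp_mul {u : EuclideanSpace ℝ (Fin d) → 𝔸}
    {x : EuclideanSpace ℝ (Fin d)} (hu : DifferentiableAt ℝ u x) (y : EuclideanSpace ℝ (Fin d)) :
    ∑ μ, (x μ - y μ) • covDeriv B μ (fun z => pExp B z y * u z) x =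
      pExp B x y * ∑ μ, (x μ - y μ) • partialDeriv μ u x := by
  have leibniz (μ : Fin d) : covDeriv B μ (fun z => pExp B z y * u z) x =
      covDeriv B μ (fun z => pExp B z y) x * u x + pExp B x y * partialDeriv μ u x :=
    covDeriv_mul_eq_covDeriv_mul_add ((contDiff_pExp hB y).differentiable (by simp) x) hu μ
  simp only [leibniz, smul_add, Finset.sum_add_distrib, ← smul_mul_assoc, ← Finset.sum_mul,
    sum_smul_covDeriv_pExp hB, zero_mul, zero_add, Finset.mul_sum, mul_smul_comm]

theorem seeleyDeWitt_succ {n : ℕ} {y : EuclideanSpace ℝ (Fin d)}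
    (smooth : ContDiff ℝ ∞ fun x => seeleyDeWitt B n x y) (x : EuclideanSpace ℝ (Fin d)) :
    seeleyDeWitt B (n + 1) x y = pExp B x y * radialIntegral n
      (fun z => pExp B y z * -covLaplace B (fun z => seeleyDeWitt B n z y) z) y x := by
  rw [mul_radialIntegral
    ((contDiff_pExp_right hB y).mul (contDiff_covLaplace hB smooth).neg).continuous]
  simp only [seeleyDeWitt, radialIntegral, ← pExp_mul_pExp_segPoint hB x y, mul_assoc, mul_neg,
    smul_neg, intervalIntegral.integral_neg]

theorem contDiff_seeleyDeWitt (n : ℕ) (y : EuclideanSpace ℝ (Fin d)) :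
    ContDiff ℝ ∞ fun x => seeleyDeWitt B n x y := by
  induction n with
  | zero => exact contDiff_pExp hB y
  | succ n ih =>
    simp only [seeleyDeWitt_succ hB ih]
    exact (contDiff_pExp hB y).mul (contDiff_radialIntegral
      ((contDiff_pExp_right hB y).mul (contDiff_covLaplace hB ih).neg) n y)

theorem isClassicalSolution_seeleyDeWitt : IsClassicalSolution B (seeleyDeWitt B) where
  smooth := contDiff_seeleyDeWitt hB
  diag_zero := pExp_self hB
  transport_zero := sum_smul_covDeriv_pExp hB
  transport_succ n x y := by
    have source : ContDiff ℝ ∞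
        fun z => pExp B y z * -covLaplace B (fun z => seeleyDeWitt B n z y) z :=
      (contDiff_pExp_right hB y).mul (contDiff_covLaplace hB (contDiff_seeleyDeWitt hB n y)).neg
    simp only [seeleyDeWitt_succ hB (contDiff_seeleyDeWitt hB n y)]
    rw [sum_smul_covDeriv_pExp_mul hB
        ((contDiff_radialIntegral source n y).differentiable (by simp) x),
      ← mul_smul_comm, ← mul_add, euler_radialIntegral source, ← mul_assoc,
      pExp_mul_pExp_symm hB, one_mul]

end Solution

/-! ### Contracted words in the covariant derivatives -/

section CanonicalCommutation

variable {K M V ι : Type*} [CommRing K] [AddCommGroup M] [Module K M] [AddCommGroup V] [Module K V]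
  [Fintype ι] [DecidableEq ι]

/-- Operators `D i`, `X j` with the commutation relations of `∂_i` and multiplication by the
coordinate `x^j`, and a map `ev` with the property of evaluation at the origin that it annihilates
the multiples of the coordinates. -/
structure IsCanonicalSystem (D X : ι → Module.End K M) (ev : M →ₗ[K] V) : Prop where
  lie_eq : ∀ i j, ⁅D i, X j⁆ = if i = j then 1 else 0
  ev_eq_zero : ∀ j f, ev (X j f) = 0

/-- The words obtained from a word by moving one of its letters to the end, one for each letter. -/
def moveLast {α : Type*} : List α → List (List α)
  | [] => []
  | a :: w => (w ++ [a]) :: (moveLast w).map (a :: ·)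

theorem moveLast_map {α β : Type*} (g : α → β) (w : List α) :
    moveLast (w.map g) = (moveLast w).map (List.map g) := by
  induction w with
  | nil => rfl
  | cons a w ih => simp [moveLast, ih, Function.comp_def]

theorem prod_map_mul_sum {A : Type*} [Ring A] {D X : ι → A}
    (h : ∀ i j, ⁅D i, X j⁆ = if i = j then 1 else 0) (w : List ι) :
    (w.map D).prod * ∑ i, X i * D i =
      ∑ i, X i * ((w.map D).prod * D i) + ((moveLast w).map fun u => (u.map D).prod).sum := by
  have comm : ∀ i j, D i * X j = X j * D i + if i = j then 1 else 0 := fun i j => by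
    rw [← h, Ring.lie_def, add_sub_cancel]
  induction w with
  | nil => simp [moveLast]
  | cons a w ih =>
    have move_head : D a * ∑ i, X i * ((w.map D).prod * D i) =
        ∑ i, X i * (D a * (w.map D).prod * D i) + (w.map D).prod * D a := by
      simp only [Finset.mul_sum, ← mul_assoc, comm, add_mul, Finset.sum_add_distrib, ite_mul,
        one_mul, zero_mul, Finset.sum_ite_eq, Finset.mem_univ, if_true]
    simp only [List.map_cons, List.prod_cons, mul_assoc, ih, mul_add, move_head, moveLast,
      List.sum_cons, List.map_append, List.prod_append, List.map_nil, List.prod_nil, mul_one,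
      List.map_map, Function.comp_def, List.sum_map_mul_left, add_assoc]

theorem IsCanonicalSystem.ev_prod_radial {D X : ι → Module.End K M} {ev : M →ₗ[K] V}
    (h : IsCanonicalSystem D X ev) (w : List ι) (f : M) :
    ev ((w.map D).prod (∑ i, X i (D i f))) =
      ((moveLast w).map fun u => ev ((u.map D).prod f)).sum := by
  have key := congrArg ev (LinearMap.congr_fun (prod_map_mul_sum h.lie_eq w) f)
  have ev_list_sum : ∀ l : List (Module.End K M),
      ev (l.sum f) = (l.map fun T => ev (T f)).sum := fun l => by
    induction l <;> simp_all
  simpa [h.ev_eq_zero, ev_list_sum, Function.comp_def] using key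

end CanonicalCommutation

section Contraction

variable {K M V ι : Type*} [CommRing K] [AddCommGroup M] [Module K M] [AddCommGroup V] [Module K V]
  [Fintype ι] {k : ℕ} (D : ι → Module.End K M) (ev : M →ₗ[K] V)

/-- The monomial of the free algebra spelled by a word. -/
def word (w : List (Fin k)) : FreeAlgebra K (Fin k) := (w.map (FreeAlgebra.ι K)).prod

theorem word_mul_word (u w : List (Fin k)) :
    (word u * word w : FreeAlgebra K (Fin k)) = word (u ++ w) := by
  simp [word]

/-- The functional `f ↦ ∑ ev (P(D_{i₁}, …, D_{iₖ}) f)`, summed over all indices `i₁, …, iₖ`: the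
generators of the free algebra stand for summation indices. -/
def contraction : FreeAlgebra K (Fin k) →ₗ[K] M →ₗ[K] V :=
  ∑ g : Fin k → ι, LinearMap.compRight K ev ∘ₗ (FreeAlgebra.lift K (D ∘ g)).toLinearMap

theorem contraction_apply (P : FreeAlgebra K (Fin k)) (f : M) :
    contraction D ev P f = ∑ g : Fin k → ι, ev (FreeAlgebra.lift K (D ∘ g) P f) := by
  simp [contraction]

theorem lift_word {A : Type*} [Ring A] [Algebra K A] (g : Fin k → A) (w : List (Fin k)) :
    FreeAlgebra.lift K g (word w) = (w.map g).prod := by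
  simp [word, map_list_prod, Function.comp_def]

theorem contraction_word (w : List (Fin k)) (f : M) :
    contraction D ev (word w) f = ∑ g : Fin k → ι, ev ((w.map (D ∘ g)).prod f) := by
  simp only [contraction_apply, lift_word]

theorem contraction_word_map_perm (ρ : Equiv.Perm (Fin k)) (w : List (Fin k)) :
    contraction D ev (word (w.map ρ)) = contraction D ev (word w) := by
  ext f
  simp only [contraction_word, List.map_map]
  exact Equiv.sum_comp (ρ.symm.arrowCongr (Equiv.refl ι))
    fun g => ev ((w.map (D ∘ g)).prod f)

theorem sum_fin_succ_arrow {A : Type*} [AddCommMonoid A] (φ : (Fin (k + 1) → ι) → A) :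
    ∑ g, φ g = ∑ g : Fin k → ι, ∑ i, φ (Fin.snoc g i) := by
  rw [← (Fin.snocEquiv fun _ => ι).sum_comp, Fintype.sum_prod_type_right]
  rfl

theorem contraction_word_laplace (w : List (Fin k)) (f : M) :
    contraction D ev (word w) (∑ i, D i (D i f)) =
      contraction D ev (word (w.map Fin.castSucc ++ [Fin.last k, Fin.last k])) f := by
  simp [contraction_word, sum_fin_succ_arrow, Function.comp_def, Finset.sum_comm (γ := ι)]

theorem contraction_three (P : FreeAlgebra K (Fin 3)) (f : M) :
    contraction D ev P f = ∑ μ, ∑ τ, ∑ ν, ev (FreeAlgebra.lift K (D ∘ ![μ, τ, ν]) P f) := by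
  have snoc_eq : ∀ (g : Fin 0 → ι) μ τ ν,
      (Fin.snoc (Fin.snoc (Fin.snoc g μ : Fin 1 → ι) τ : Fin 2 → ι) ν : Fin 3 → ι) =
        ![μ, τ, ν] := by
    intro g μ τ ν
    ext i
    fin_cases i <;> rfl
  simp only [contraction_apply, sum_fin_succ_arrow, snoc_eq, Finset.univ_unique, Finset.sum_const,
    Finset.card_singleton, one_smul]

variable {D ev} {X : ι → Module.End K M} [DecidableEq ι]

theorem IsCanonicalSystem.contraction_word_radial (h : IsCanonicalSystem D X ev)
    (w : List (Fin k)) (f : M) :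
    contraction D ev (word w) (∑ i, X i (D i f)) =
      ((moveLast w).map fun u => contraction D ev (word u) f).sum := by
  have sum_comm : ∀ (l : List (List (Fin k))) (φ : (Fin k → ι) → List (Fin k) → V),
      ∑ g, (l.map (φ g)).sum = (l.map fun u => ∑ g, φ g u).sum := fun l φ => by
    induction l <;> simp_all [Finset.sum_add_distrib]
  simp only [contraction_word, ← List.map_map, h.ev_prod_radial, moveLast_map, ← sum_comm]
  simp [Function.comp_def]

theorem IsCanonicalSystem.contraction_word_eq_of_transport (h : IsCanonicalSystem D X ev)
    {c : K} {f f' : M} (hf : c • f + ∑ i, X i (D i f) = ∑ i, D i (D i f')) (w : List (Fin k)) :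
    c • contraction D ev (word w) f + ((moveLast w).map fun u => contraction D ev (word u) f).sum =
      contraction D ev (word (w.map Fin.castSucc ++ [Fin.last k, Fin.last k])) f' := by
  rw [← h.contraction_word_radial, ← contraction_word_laplace, ← hf, map_add, map_smul]

end Contraction

section Renaming

variable {K V : Type*} [CommRing K] [AddCommGroup V] [Module K V]
  {φ : FreeAlgebra K (Fin 3) →ₗ[K] V}
  (perm : ∀ (ρ : Equiv.Perm (Fin 3)) w, φ (word (w.map ρ)) = φ (word w))
include perm

theorem map_word_one_cons (w : List (Fin 3)) :
    φ (word (1 :: w)) = φ (word (0 :: w.map (Equiv.swap 0 1))) := by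
  simp [← perm (Equiv.swap 0 1) (1 :: w)]

theorem map_word_two_cons (w : List (Fin 3)) :
    φ (word (2 :: w)) = φ (word (0 :: w.map (Equiv.swap 0 2))) := by
  simp [← perm (Equiv.swap 0 2) (2 :: w)]

theorem map_word_zero_two_cons (w : List (Fin 3)) :
    φ (word (0 :: 2 :: w)) = φ (word (0 :: 1 :: w.map (Equiv.swap 1 2))) := by
  simp [← perm (Equiv.swap 1 2) (0 :: 2 :: w), Equiv.swap_apply_def]

theorem map_word_zero_zero_two_cons (w : List (Fin 3)) :
    φ (word (0 :: 0 :: 2 :: w)) = φ (word (0 :: 0 :: 1 :: w.map (Equiv.swap 1 2))) := by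
  simp [← perm (Equiv.swap 1 2) (0 :: 0 :: 2 :: w), Equiv.swap_apply_def]

end Renaming

section ThirdCoefficient

variable {K M V ι : Type*} [Field K] [CharZero K] [AddCommGroup M] [Module K M] [AddCommGroup V]
  [Module K V]

/-- The polynomial in `D` expressing the coefficient `a₃` on the diagonal through `a₀`; each
generator stands for a summation index, so that `0` occurring twice means `D_μ … D_μ …`.

Its coefficients come from `3 a₃ = aa a₂`, `4 aa a₂ = aabb a₁` and the following relations, where
a word `w` on the left is applied to `a₁`, `wcc` on the right to `a₀`, and the words are
contracted:
`3 aabb + 2 abba = aabbcc`, `aabb + 2 abba + 2 abab = abbacc`, `aabb + abba + 3 abab = ababcc`. -/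
def heatPolynomial : FreeAlgebra K (Fin 3) :=
  (1 / 30 : K) • word [0, 0, 1, 1, 2, 2] - (1 / 20 : K) • word [0, 1, 1, 0, 2, 2]
    + (1 / 30 : K) • word [0, 1, 0, 1, 2, 2]

theorem IsCanonicalSystem.ev_third [Fintype ι] [DecidableEq ι] {D X : ι → Module.End K M}
    {ev : M →ₗ[K] V} (h : IsCanonicalSystem D X ev) {a : ℕ → M}
    (ha : ∀ n : ℕ, ((n : K) + 1) • a (n + 1) + ∑ i, X i (D i (a (n + 1))) = ∑ i, D i (D i (a n))) :
    ev (a 3) = contraction D ev heatPolynomial (a 0) := by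
  have rename (l : List (Fin 2)) :=
    contraction_word_map_perm D ev (Equiv.swap 0 1) (1 :: l)
  have third : ev (a 3) = contraction D ev (word (k := 0) []) (a 3) := by
    simp [contraction_word]
  have eq₂ := h.contraction_word_eq_of_transport (k := 0) (ha 2) []
  have eq₁ := h.contraction_word_eq_of_transport (k := 1) (ha 1) [0, 0]
  have eq_aabb := h.contraction_word_eq_of_transport (k := 2) (ha 0) [0, 0, 1, 1]
  have eq_abba := h.contraction_word_eq_of_transport (k := 2) (ha 0) [0, 1, 1, 0]
  have eq_abab := h.contraction_word_eq_of_transport (k := 2) (ha 0) [0, 1, 0, 1]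
  simp only [Nat.cast_ofNat, Nat.reduceAdd, moveLast, List.map_nil, List.sum_nil, add_zero,
    Fin.last_zero, Fin.isValue, List.nil_append, Nat.cast_one, List.cons_append, List.map_cons,
    List.sum_cons, Fin.castSucc_zero, Fin.reduceLast, CharP.cast_eq_zero, zero_add, one_smul,
    Fin.castSucc_one, ← rename, Equiv.swap_apply_right, Equiv.swap_apply_left]
    at eq₂ eq₁ eq_aabb eq_abba eq_abab
  simp only [heatPolynomial, map_add, map_sub, map_smul, LinearMap.add_apply, LinearMap.sub_apply,
    LinearMap.smul_apply]
  linear_combination (norm := module) third + (1 / 3 : K) • eq₂ + (1 / 12 : K) • eq₁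
    + (1 / 30 : K) • eq_aabb - (1 / 20 : K) • eq_abba + (1 / 30 : K) • eq_abab

/-- The expression for `a₃` on the diagonal in terms of the curvature, as a polynomial in `D`: the
generators `0`, `1`, `2` stand for `D_μ`, `D_τ`, `D_ν`, and `F_{τν} = [D_τ, D_ν]`,
`∇_μ G = [D_μ, G]`. -/
def curvaturePolynomial : FreeAlgebra K (Fin 3) :=
  let x : Fin 3 → FreeAlgebra K (Fin 3) := FreeAlgebra.ι K
  (1 / 45 : K) • (⁅x 0, ⁅x 1, x 2⁆⁆ * ⁅x 0, ⁅x 1, x 2⁆⁆)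
    + (1 / 180 : K) • (⁅x 0, ⁅x 0, x 2⁆⁆ * ⁅x 1, ⁅x 1, x 2⁆⁆)
    + (1 / 60 : K) • (⁅x 1, x 2⁆ * ⁅x 0, ⁅x 0, ⁅x 1, x 2⁆⁆⁆ + ⁅x 0, ⁅x 0, ⁅x 1, x 2⁆⁆⁆ * ⁅x 1, x 2⁆)
    - (1 / 30 : K) • (⁅x 1, x 0⁆ * ⁅x 0, x 2⁆ * ⁅x 2, x 1⁆)

theorem map_curvaturePolynomial {φ : FreeAlgebra K (Fin 3) →ₗ[K] V}
    (perm : ∀ (ρ : Equiv.Perm (Fin 3)) w, φ (word (w.map ρ)) = φ (word w))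
    (radial : ∀ w, ((moveLast w).map fun u => φ (word u)).sum = 0) :
    φ curvaturePolynomial = φ heatPolynomial := by
  -- Modulo renaming of the letters there are fifteen words; the coefficients below solve the
  -- linear system which expresses the difference of the two polynomials through these relations.
  have r₁ := radial [0, 0, 1, 1, 2, 2]
  have r₂ := radial [0, 1, 0, 2, 1, 2]
  have r₃ := radial [0, 1, 2, 0, 1, 2]
  have r₄ := radial [0, 1, 2, 2, 0, 1]
  have r₅ := radial [0, 1, 2, 2, 1, 0]
  simp only [moveLast, List.map_nil, List.map_cons, List.cons_append, List.nil_append,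
    map_word_one_cons perm, map_word_zero_two_cons perm, map_word_zero_zero_two_cons perm,
    Equiv.swap_apply_def, reduceIte, Fin.reduceEq] at r₁ r₂ r₃ r₄ r₅
  have ι_eq (i : Fin 3) : FreeAlgebra.ι K i = word [i] := by simp [word]
  simp only [curvaturePolynomial, heatPolynomial, ι_eq, Ring.lie_def, mul_sub, sub_mul,
    word_mul_word, List.cons_append, List.nil_append, map_sub, map_add, map_smul,
    map_word_one_cons perm, map_word_two_cons perm, map_word_zero_two_cons perm,
    map_word_zero_zero_two_cons perm, List.map_cons, List.map_nil, Equiv.swap_apply_def, reduceIte,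
    Fin.reduceEq]
  simp only [List.sum_cons, List.sum_nil] at r₁ r₂ r₃ r₄ r₅
  linear_combination (norm := module) (1 / 45 : K) • r₂ - (1 / 72 : K) • r₁ - (1 / 30 : K) • r₃
    + (1 / 36 : K) • r₄ - (1 / 180 : K) • r₅

theorem IsCanonicalSystem.ev_third_eq_curvature [Fintype ι] [DecidableEq ι]
    {D X : ι → Module.End K M} {ev : M →ₗ[K] V} (h : IsCanonicalSystem D X ev) {a : ℕ → M}
    (h₀ : ∑ i, X i (D i (a 0)) = 0)
    (ha : ∀ n : ℕ, ((n : K) + 1) • a (n + 1) + ∑ i, X i (D i (a (n + 1))) = ∑ i, D i (D i (a n))) :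
    ev (a 3) = contraction D ev curvaturePolynomial (a 0) := by
  rw [h.ev_third ha]
  symm
  refine map_curvaturePolynomial (φ := (contraction D ev).flip (a 0)) (fun ρ w => ?_) fun w => ?_
  · simp only [LinearMap.flip_apply, contraction_word_map_perm]
  · simp only [LinearMap.flip_apply, ← h.contraction_word_radial, h₀, map_zero]

end ThirdCoefficient

/-! ### The third coefficient on the diagonal -/

section SmoothOperators

variable {d : ℕ} {𝔸 : Type*} [NormedRing 𝔸] [NormedAlgebra ℝ 𝔸]
  {B : Fin d → EuclideanSpace ℝ (Fin d) → 𝔸}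

/-- The algebra of smooth functions on `ℝ^d`, on which the covariant derivatives and the
multiplications by coordinates operate. -/
def smoothFunctions (d : ℕ) (𝔸 : Type*) [NormedRing 𝔸] [NormedAlgebra ℝ 𝔸] :
    Subalgebra ℝ (EuclideanSpace ℝ (Fin d) → 𝔸) where
  carrier := {f | ContDiff ℝ ∞ f}
  mul_mem' hf hg := Set.mem_ofPred.2 ((Set.mem_ofPred.1 hf).mul (Set.mem_ofPred.1 hg))
  add_mem' hf hg := Set.mem_ofPred.2 ((Set.mem_ofPred.1 hf).add (Set.mem_ofPred.1 hg))
  algebraMap_mem' _ := Set.mem_ofPred.2 contDiff_const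

theorem contDiff_coe (f : smoothFunctions d 𝔸) : ContDiff ℝ ∞ f.1 := f.2

theorem differentiableAt_coe (f : smoothFunctions d 𝔸) (x : EuclideanSpace ℝ (Fin d)) :
    DifferentiableAt ℝ f.1 x :=
  (contDiff_coe f).differentiable (by simp) x

/-- Evaluation of smooth functions at a point. -/
def evalAt (y : EuclideanSpace ℝ (Fin d)) : smoothFunctions d 𝔸 →ₐ[ℝ] 𝔸 :=
  (Pi.evalAlgHom ℝ (fun _ : EuclideanSpace ℝ (Fin d) => 𝔸) y).comp (smoothFunctions d 𝔸).val

/-- Multiplication by the coordinate `(x - y)^ν`, as an operator on smooth functions. -/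
def coordOp (y : EuclideanSpace ℝ (Fin d)) (ν : Fin d) :
    Module.End ℝ (smoothFunctions d 𝔸) where
  toFun f := ⟨fun x => (x ν - y ν) • f.1 x,
    ContDiff.smul (f := fun x : EuclideanSpace ℝ (Fin d) => x ν - y ν) (by fun_prop)
      (contDiff_coe f)⟩
  map_add' _ _ := Subtype.ext (funext fun _ => smul_add _ _ _)
  map_smul' _ _ := Subtype.ext (funext fun _ => smul_comm _ _ _)

variable (hB : ∀ μ, ContDiff ℝ ∞ (B μ))

/-- The covariant derivative `D_μ` as an operator on smooth functions. -/
def covOp (μ : Fin d) : Module.End ℝ (smoothFunctions d 𝔸) where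
  toFun f := ⟨covDeriv B μ f.1, contDiff_covDeriv hB (contDiff_coe f) μ⟩
  map_add' f g := Subtype.ext <| funext fun x =>
    covDeriv_add (differentiableAt_coe f x) (differentiableAt_coe g x) μ
  map_smul' c f := Subtype.ext <| funext fun x => covDeriv_const_smul (differentiableAt_coe f x) c μ

/-- The field strength `F_{μν}` as a smooth function. -/
def curvature (μ ν : Fin d) : smoothFunctions d 𝔸 :=
  ⟨fieldStrength B μ ν, contDiff_fieldStrength hB μ ν⟩

/-- The adjoint covariant derivative `∇_μ` on smooth functions. -/
def adjOp (μ : Fin d) (f : smoothFunctions d 𝔸) : smoothFunctions d 𝔸 :=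
  ⟨adjDeriv B μ f.1, contDiff_adjDeriv hB (contDiff_coe f) μ⟩

theorem isCanonicalSystem_covOp (y : EuclideanSpace ℝ (Fin d)) :
    IsCanonicalSystem (covOp hB) (coordOp y) (evalAt y).toLinearMap where
  lie_eq μ ν := by
    rw [Ring.lie_def, sub_eq_iff_eq_add']
    ext f x
    refine (covDeriv_coord_smul (differentiableAt_coe f x) y μ ν).trans ?_
    split_ifs <;> rfl
  ev_eq_zero ν f := by
    change (y ν - y ν) • f.1 y = 0
    rw [sub_self, zero_smul]

theorem lie_covOp_covOp (μ ν : Fin d) :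
    ⁅covOp hB μ, covOp hB ν⁆ = LinearMap.mulLeft ℝ (curvature hB μ ν) := by
  ext f x
  exact covDeriv_covDeriv_sub (fun μ => (hB μ).differentiable (by simp) x)
    ((contDiff_coe f).contDiffAt.of_le (by simpa using ENat.LEInfty.out (m := 2))) μ ν

theorem lie_covOp_mulLeft (μ : Fin d) (G : smoothFunctions d 𝔸) :
    ⁅covOp hB μ, LinearMap.mulLeft ℝ G⁆ = LinearMap.mulLeft ℝ (adjOp hB μ G) := by
  rw [Ring.lie_def, sub_eq_iff_eq_add]
  ext f x
  exact covDeriv_mul_eq_adjDeriv_mul_add (differentiableAt_coe G x) (differentiableAt_coe f x) μ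

theorem evalAt_lift_curvaturePolynomial (y : EuclideanSpace ℝ (Fin d)) (μ τ ν : Fin d)
    (f : smoothFunctions d 𝔸) :
    evalAt y (FreeAlgebra.lift ℝ (covOp hB ∘ ![μ, τ, ν]) curvaturePolynomial f) =
      ((1 / 45 : ℝ) •
          (adjDeriv B μ (fieldStrength B τ ν) y * adjDeriv B μ (fieldStrength B τ ν) y)
        + (1 / 180 : ℝ) •
          (adjDeriv B μ (fieldStrength B μ ν) y * adjDeriv B τ (fieldStrength B τ ν) y)
        + (1 / 60 : ℝ) •
          (fieldStrength B τ ν y * adjDeriv B μ (adjDeriv B μ (fieldStrength B τ ν)) y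
            + adjDeriv B μ (adjDeriv B μ (fieldStrength B τ ν)) y * fieldStrength B τ ν y)
        - (1 / 30 : ℝ) •
          (fieldStrength B τ μ y * fieldStrength B μ ν y * fieldStrength B ν τ y)) *
        evalAt y f := by
  have lift_lie (P Q : FreeAlgebra ℝ (Fin 3)) :
      FreeAlgebra.lift ℝ (covOp hB ∘ ![μ, τ, ν]) ⁅P, Q⁆ =
        ⁅FreeAlgebra.lift ℝ (covOp hB ∘ ![μ, τ, ν]) P,
          FreeAlgebra.lift ℝ (covOp hB ∘ ![μ, τ, ν]) Q⁆ := by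
    simp only [Ring.lie_def, map_sub, map_mul]
  have evalAt_curvature μ ν : evalAt y (curvature hB μ ν) = fieldStrength B μ ν y := rfl
  have evalAt_adjOp μ G : evalAt y (adjOp hB μ G) = adjDeriv B μ G.1 y := rfl
  have coe_curvature μ ν : (curvature hB μ ν).1 = fieldStrength B μ ν := rfl
  have coe_adjOp μ G : (adjOp hB μ G).1 = adjDeriv B μ G.1 := rfl
  simp only [curvaturePolynomial, map_add, map_sub, map_mul, map_smul, lift_lie,
    FreeAlgebra.lift_ι_apply, Function.comp_apply, Matrix.cons_val, lie_covOp_covOp,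
    lie_covOp_mulLeft, LinearMap.add_apply, LinearMap.sub_apply, LinearMap.smul_apply,
    Module.End.mul_apply, LinearMap.mulLeft_apply, evalAt_curvature, evalAt_adjOp, coe_curvature,
    coe_adjOp, add_mul, sub_mul, smul_mul_assoc, mul_assoc]

theorem IsClassicalSolution.third_diagonal (hB : ∀ μ, ContDiff ℝ ∞ (B μ))
    {a : ℕ → EuclideanSpace ℝ (Fin d) → EuclideanSpace ℝ (Fin d) → 𝔸}
    (ha : IsClassicalSolution B a) (x : EuclideanSpace ℝ (Fin d)) :
    a 3 x x =
      (1 / 45 : ℝ) • ∑ μ, ∑ τ, ∑ ν,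
          adjDeriv B μ (fieldStrength B τ ν) x * adjDeriv B μ (fieldStrength B τ ν) x
      + (1 / 180 : ℝ) • ∑ μ, ∑ τ, ∑ ν,
          adjDeriv B μ (fieldStrength B μ ν) x * adjDeriv B τ (fieldStrength B τ ν) x
      + (1 / 60 : ℝ) • ∑ μ, ∑ τ, ∑ ν,
          (fieldStrength B τ ν x * adjDeriv B μ (adjDeriv B μ (fieldStrength B τ ν)) x
            + adjDeriv B μ (adjDeriv B μ (fieldStrength B τ ν)) x * fieldStrength B τ ν x)
      - (1 / 30 : ℝ) • ∑ μ, ∑ τ, ∑ ν,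
          fieldStrength B τ μ x * fieldStrength B μ ν x * fieldStrength B ν τ x := by
  let α (n : ℕ) : smoothFunctions d 𝔸 := ⟨fun z => a n z x, ha.smooth n x⟩
  have coe_sum (s : Fin d → smoothFunctions d 𝔸) z : (∑ μ, s μ).1 z = ∑ μ, (s μ).1 z := by
    simp
  have transport_zero : ∑ μ, coordOp x μ (covOp hB μ (α 0)) = 0 := by
    ext z
    exact (coe_sum _ z).trans (ha.transport_zero z x)
  have transport_succ (n : ℕ) : ((n : ℝ) + 1) • α (n + 1) +
      ∑ μ, coordOp x μ (covOp hB μ (α (n + 1))) = ∑ μ, covOp hB μ (covOp hB μ (α n)) := by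
    ext z
    have eq := ha.transport_succ n z x
    rw [covLaplace, neg_neg] at eq
    refine Eq.trans ?_ (eq.trans (coe_sum (fun μ => covOp hB μ (covOp hB μ (α n))) z).symm)
    exact congrArg (((n : ℝ) + 1) • a (n + 1) z x + ·) (coe_sum _ z)
  have key : a 3 x x = contraction (covOp hB) (evalAt x).toLinearMap curvaturePolynomial (α 0) :=
    (isCanonicalSystem_covOp hB x).ev_third_eq_curvature transport_zero transport_succ
  have eval_zero : evalAt x (α 0) = 1 := ha.diag_zero x
  rw [key, contraction_three]
  simp only [AlgHom.toLinearMap_apply, evalAt_lift_curvaturePolynomial, eval_zero, mul_one,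
    Finset.sum_add_distrib, Finset.sum_sub_distrib, ← Finset.smul_sum]

end SmoothOperators

end HeatKernel

end

theorem mainTheorem7_general {𝔸 : Type*} [NormedRing 𝔸] [NormedAlgebra ℝ 𝔸] [CompleteSpace 𝔸]
    {d : ℕ} {B : Fin d → EuclideanSpace ℝ (Fin d) → 𝔸} (hB : ∀ μ, ContDiff ℝ ∞ (B μ)) :
    HeatKernel.IsClassicalSolution B (HeatKernel.seeleyDeWitt B) ∧
    ∀ a : ℕ → EuclideanSpace ℝ (Fin d) → EuclideanSpace ℝ (Fin d) → 𝔸,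
      HeatKernel.IsClassicalSolution B a →
      ∀ x : EuclideanSpace ℝ (Fin d),
        a 3 x x =
          (1 / 45 : ℝ) • ∑ μ, ∑ τ, ∑ ν,
              HeatKernel.adjDeriv B μ (HeatKernel.fieldStrength B τ ν) x *
                HeatKernel.adjDeriv B μ (HeatKernel.fieldStrength B τ ν) x
          + (1 / 180 : ℝ) • ∑ μ, ∑ τ, ∑ ν,
              HeatKernel.adjDeriv B μ (HeatKernel.fieldStrength B μ ν) x *
                HeatKernel.adjDeriv B τ (HeatKernel.fieldStrength B τ ν) x
          + (1 / 60 : ℝ) • ∑ μ, ∑ τ, ∑ ν,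
              (HeatKernel.fieldStrength B τ ν x *
                  HeatKernel.adjDeriv B μ
                    (HeatKernel.adjDeriv B μ (HeatKernel.fieldStrength B τ ν)) x
                + HeatKernel.adjDeriv B μ
                    (HeatKernel.adjDeriv B μ (HeatKernel.fieldStrength B τ ν)) x *
                  HeatKernel.fieldStrength B τ ν x)
          - (1 / 30 : ℝ) • ∑ μ, ∑ τ, ∑ ν,
              HeatKernel.fieldStrength B τ μ x * HeatKernel.fieldStrength B μ ν x *
                HeatKernel.fieldStrength B ν τ x :=
  ⟨HeatKernel.isClassicalSolution_seeleyDeWitt hB, fun _ ha x => ha.third_diagonal hB x⟩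

theorem mainTheorem7 {𝕜 : Type*} [RCLike 𝕜] (d N : ℕ)
    (B : Fin d → EuclideanSpace ℝ (Fin d) → Matrix (Fin N) (Fin N) 𝕜)
    (hB : ∀ μ, ContDiff ℝ ∞ (B μ)) :
    HeatKernel.IsClassicalSolution B (HeatKernel.seeleyDeWitt B) ∧
    ∀ a : ℕ → EuclideanSpace ℝ (Fin d) → EuclideanSpace ℝ (Fin d) → Matrix (Fin N) (Fin N) 𝕜,
      HeatKernel.IsClassicalSolution B a →
      ∀ x : EuclideanSpace ℝ (Fin d),
        a 3 x x =
          (1 / 45 : ℝ) • ∑ μ, ∑ τ, ∑ ν,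
              HeatKernel.adjDeriv B μ (HeatKernel.fieldStrength B τ ν) x *
                HeatKernel.adjDeriv B μ (HeatKernel.fieldStrength B τ ν) x
          + (1 / 180 : ℝ) • ∑ μ, ∑ τ, ∑ ν,
              HeatKernel.adjDeriv B μ (HeatKernel.fieldStrength B μ ν) x *
                HeatKernel.adjDeriv B τ (HeatKernel.fieldStrength B τ ν) x
          + (1 / 60 : ℝ) • ∑ μ, ∑ τ, ∑ ν,
              (HeatKernel.fieldStrength B τ ν x *
                  HeatKernel.adjDeriv B μ
                    (HeatKernel.adjDeriv B μ (HeatKernel.fieldStrength B τ ν)) x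
                + HeatKernel.adjDeriv B μ
                    (HeatKernel.adjDeriv B μ (HeatKernel.fieldStrength B τ ν)) x *
                  HeatKernel.fieldStrength B τ ν x)
          - (1 / 30 : ℝ) • ∑ μ, ∑ τ, ∑ ν,
              HeatKernel.fieldStrength B τ μ x * HeatKernel.fieldStrength B μ ν x *
                HeatKernel.fieldStrength B ν τ x := by
  have : CompleteSpace (Matrix (Fin N) (Fin N) 𝕜) := FiniteDimensional.complete ℝ _
  exact mainTheorem7_general hB
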